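/- Let $U$ be a nonprincipal ultrafilter on a set $I$. For a set $A$ let ${}^*A=A^I/U$ be the ultrapower, with $A$ embedded in ${}^*A$ by constant families. A subset of ${}^*A$ is internal if it has the form $\{[x_i] : x_i\in S_i \text{ for } U\text{-almost all } i\}$ for some family $(S_i)_{i\in I}$ of subsets of $A$; write $[S_i]$ for this set. The extension monad $\widehat{G}$ of a group $G$ is the intersection of all internal subgroups of ${}^*G$ that contain $G$. For a set $X$ of nonzero rationals let $X_0=X$ and $X_{n+1}=\{1\}\cup\{x^{-1}:x\in X_n\}\cup\{xy:x,y\in X_n\}$ for $n\in\mathbb N$. For an internal set $S=[S_i]$ of nonzero elements of ${}^*\mathbb Q$ and $\nu=[n_i]\in{}^*\mathbb N$ let $S_\nu=[(S_i)_{n_i}]$ (the $\nu$-th stage of the ${}^*$-transformed process; the $S_i$ may be taken to consist of nonzero rationals). For an arbitrary, possibly external, set $F$ of nonzero elements of ${}^*\mathbb Q$, let $$\langle F\rangle^{(int)}_{({}^*\mathbb Q;\cdot)}=\bigcup_{\nu\in{}^*\mathbb N}F_\nu,\qquad F_\nu=\bigcup\{S_\nu : S\subseteq F,\ S \text{ internal}\},$$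 the closure of $F$ under hyperfinitely many iterations of the group operations. Then the extension monad of the multiplicative group $\mathbb Q\setminus\{0\}$, regarded as a subset of ${}^*\mathbb Q$ via ${}^*(\mathbb Q\setminus\{0\})\subseteq{}^*\mathbb Q$, is $$\widehat{\mathbb Q\setminus\{0\}}=\langle \mathbb Q\setminus\{0\}\rangle^{(int)}_{({}^*\mathbb Q;\cdot)}.$$ -/

import Mathlib

namespace ExtMonad

open Filter

/-- The ultrapower enlargement `*A` of a set `A` by an ultrafilter `U`. -/
abbrev Star {I : Type*} (U : Ultrafilter I) (A : Type*) : Type _ := (U : Filter I).Germ A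

/-- The canonical embedding `A → *A`, sending `a` to the class of the constant family. -/
def std {I : Type*} (U : Ultrafilter I) {A : Type*} (a : A) : Star U A :=
  Germ.ofFun fun _ => a

/-- The subset of `*A` coded by an element `S` of `*(𝒫 A)`: for `x = [x_i]` and `S = [S_i]`,
`x` belongs to it iff `x_i ∈ S_i` for `U`-almost all `i`. -/
def internalSet {I : Type*} {U : Ultrafilter I} {A : Type*} (S : Star U (Set A)) :
    Set (Star U A) :=
  {x | Germ.LiftRel (fun a X => a ∈ X) x S}

/-- A subset of `*A` is internal if it is (coded by) an element of `*(𝒫 A)`. -/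
def IsInternal {I : Type*} {U : Ultrafilter I} {A : Type*} (B : Set (Star U A)) : Prop :=
  ∃ S : Star U (Set A), B = internalSet S

/-- The extension monad of a group `G`: the intersection of all internal subgroups of `*G`
which contain (the copy in `*G` of) `G`. -/
def extensionMonad {I : Type*} (U : Ultrafilter I) (G : Type*) [Group G] :
    Subgroup (Star U G) :=
  sInf {B : Subgroup (Star U G) | IsInternal (B : Set (Star U G)) ∧ ∀ g : G, std U g ∈ B}

/-- One application of the group operations `1`, `⁻¹`, `*` to the elements of a set. -/
def opImage {A : Type*} [One A] [Inv A] [Mul A] (X : Set A) : Set A :=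
  {z | z = 1 ∨ (∃ x ∈ X, z = x⁻¹) ∨ ∃ x ∈ X, ∃ y ∈ X, z = x * y}

/-- The standard generation process: `A_0 = X`, and `A_{n+1}` is the set of all values of the
group operations on `A_n`. -/
def genStage {A : Type*} [One A] [Inv A] [Mul A] (X : Set A) : ℕ → Set A
  | 0 => X
  | n + 1 => opImage (genStage X n)

/-- The stage `A_n`, `n ∈ *ℕ`, of the internal generation process in `*A` started from an
arbitrary (possibly external) `F ⊆ *A`.  For an internal starting set `S` the sequence of stages
is the `*`-transform `*genStage` of the standard one; a construction of hyperfinite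
depth from elements of `F` is one which starts from some internal set of elements of `F`.
That `A_0 = F` and that `A_{n+1}` is the set of values of the operations on `A_n` for every
`n ∈ *ℕ` is proved below, as well as that `A_n = *genStage F n` if `F` is internal. -/
def starStage {I : Type*} {U : Ultrafilter I} {A : Type*} [One A] [Inv A] [Mul A]
    (F : Set (Star U A)) (n : Star U ℕ) : Set (Star U A) :=
  {x | ∃ S : Star U (Set A), internalSet S ⊆ F ∧ x ∈ internalSet (Germ.map₂ genStage S n)}

/-- The internally generated substructure `⟨F⟩^(int) = ⋃_{n ∈ *ℕ} A_n` of `*A`: the closure of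
`F` under hyperfinitely many iterations of the group operations. -/
def intGen {I : Type*} {U : Ultrafilter I} {A : Type*} [One A] [Inv A] [Mul A]
    (F : Set (Star U A)) : Set (Star U A) :=
  ⋃ n : Star U ℕ, starStage F n

theorem opImage_mono {A : Type*} [One A] [Inv A] [Mul A] {X Y : Set A} (h : X ⊆ Y) :
    opImage X ⊆ opImage Y := by
  rintro z (hz | ⟨x, hx, hz⟩ | ⟨x, hx, y, hy, hz⟩)
  · exact Or.inl hz
  · exact Or.inr (Or.inl ⟨x, h hx, hz⟩)
  · exact Or.inr (Or.inr ⟨x, h hx, y, h hy, hz⟩)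

theorem genStage_mono {A : Type*} [One A] [Inv A] [Mul A] {X Y : Set A} (h : X ⊆ Y) (n : ℕ) :
    genStage X n ⊆ genStage Y n := by
  induction n with
  | zero => exact h
  | succ n ih => exact opImage_mono ih

theorem internalSet_subset_iff {I : Type*} {U : Ultrafilter I} {A : Type*} (S T : I → Set A) :
    internalSet (U := U) (↑S : Star U (Set A)) ⊆ internalSet (↑T : Star U (Set A)) ↔
      ∀ᶠ i in (U : Filter I), S i ⊆ T i := by
  constructor
  · intro h
    by_contra hc
    rw [Ultrafilter.eventually_not.symm] at hc
    have hx : ∃ x : I → A, ∀ᶠ i in (U : Filter I), x i ∈ S i ∧ x i ∉ T i := by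
      obtain ⟨i₀, hi₀⟩ := hc.exists
      obtain ⟨a₀, -, -⟩ := Set.not_subset.1 hi₀
      have : Nonempty A := ⟨a₀⟩
      have hch : ∀ i, ∃ a : A, ¬ S i ⊆ T i → a ∈ S i ∧ a ∉ T i := by
        intro i
        by_cases hi : S i ⊆ T i
        · exact ⟨a₀, fun h' => absurd hi h'⟩
        · obtain ⟨a, ha, hb⟩ := Set.not_subset.1 hi
          exact ⟨a, fun _ => ⟨ha, hb⟩⟩
      choose x hx using hch
      exact ⟨x, hc.mono fun i hi => hx i hi⟩
    obtain ⟨x, hx⟩ := hx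
    have hT : ∀ᶠ i in (U : Filter I), x i ∈ T i :=
      h (show (↑x : Star U A) ∈ internalSet (↑S : Star U (Set A)) from hx.mono fun _ hi => hi.1)
    obtain ⟨i, hi, hi'⟩ := (hx.and hT).exists
    exact hi.2 hi'
  · intro h x
    induction x using Germ.inductionOn with
    | _ x =>
      intro (hx : ∀ᶠ i in (U : Filter I), x i ∈ S i)
      exact (show ∀ᶠ i in (U : Filter I), x i ∈ T i from (hx.and h).mono fun _ hi => hi.2 hi.1)

/-- For an internal starting set, the stages are those of the `*`-transformed process. -/
theorem starStage_internalSet {I : Type*} {U : Ultrafilter I} {A : Type*} [One A] [Inv A] [Mul A]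
    (S : Star U (Set A)) (n : Star U ℕ) :
    starStage (internalSet S) n = internalSet (Germ.map₂ genStage S n) := by
  ext x
  constructor
  · rintro ⟨T, hT, hx⟩
    induction S using Germ.inductionOn with
    | _ S =>
    induction T using Germ.inductionOn with
    | _ T =>
    induction n using Germ.inductionOn with
    | _ n =>
      rw [internalSet_subset_iff] at hT
      exact (internalSet_subset_iff (fun i => genStage (T i) (n i))
        (fun i => genStage (S i) (n i))).2 (hT.mono fun i hi => genStage_mono hi (n i)) hx
  · exact fun hx => ⟨S, subset_rfl, hx⟩

/-- `A_0 = F`. -/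
theorem starStage_zero {I : Type*} {U : Ultrafilter I} {A : Type*} [One A] [Inv A] [Mul A]
    (F : Set (Star U A)) : starStage F 0 = F := by
  ext x
  constructor
  · rintro ⟨S, hS, hx⟩
    apply hS
    induction S using Germ.inductionOn with
    | _ S => exact hx
  · intro hx
    induction x using Germ.inductionOn with
    | _ x =>
      refine ⟨(↑(fun i => ({x i} : Set A)) : Star U (Set A)), ?_, ?_⟩
      · intro y
        induction y using Germ.inductionOn with
        | _ y =>
          intro (hy : ∀ᶠ i in (U : Filter I), y i ∈ ({x i} : Set A))
          have : (↑y : Star U A) = ↑x := Germ.coe_eq.2 hy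
          rwa [this]
      · exact Eventually.of_forall (f := (U : Filter I)) fun i => Set.mem_singleton (x i)

/-- `A_{n+1}` is the set of all values of the operations on `A_n`, for every `n ∈ *ℕ`. -/
theorem starStage_succ {I : Type*} {U : Ultrafilter I} {A : Type*} [One A] [Inv A] [Mul A]
    (F : Set (Star U A)) (n : Star U ℕ) : starStage F (n + 1) = opImage (starStage F n) := by
  induction n using Germ.inductionOn with
  | _ n =>
  ext z
  constructor
  · rintro ⟨S, hS, hz⟩
    induction S using Germ.inductionOn with
    | _ S =>
    induction z using Germ.inductionOn with
    | _ z =>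
    have hz' : ∀ᶠ i in (U : Filter I), z i ∈ opImage (genStage (S i) (n i)) := hz
    rcases Ultrafilter.eventually_or.1 hz' with h1 | h2
    · exact Or.inl (Germ.coe_eq.2 h1)
    rcases Ultrafilter.eventually_or.1 h2 with h2 | h3
    · have hne : Nonempty A := by
        obtain ⟨i, a, -⟩ := h2.exists
        exact ⟨a⟩
      obtain ⟨x, hx⟩ := h2.choice
      exact Or.inr (Or.inl ⟨(↑x : Star U A), ⟨_, hS, hx.mono fun _ hi => hi.1⟩,
        Germ.coe_eq.2 (hx.mono fun _ hi => hi.2)⟩)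
    · have hne : Nonempty A := by
        obtain ⟨i, a, -⟩ := h3.exists
        exact ⟨a⟩
      have h3' : ∀ᶠ i in (U : Filter I), ∃ p : A × A, p.1 ∈ genStage (S i) (n i) ∧
          p.2 ∈ genStage (S i) (n i) ∧ z i = p.1 * p.2 := by
        filter_upwards [h3] with i hi
        obtain ⟨x, hx, y, hy, h⟩ := hi
        exact ⟨(x, y), hx, hy, h⟩
      obtain ⟨p, hp⟩ := h3'.choice
      exact Or.inr (Or.inr ⟨(↑(fun i => (p i).1) : Star U A),
        ⟨_, hS, hp.mono fun _ hi => hi.1⟩, (↑(fun i => (p i).2) : Star U A),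
        ⟨_, hS, hp.mono fun _ hi => hi.2.1⟩, Germ.coe_eq.2 (hp.mono fun _ hi => hi.2.2)⟩)
  · rintro (h1 | ⟨x, ⟨S, hS, hx⟩, h2⟩ | ⟨x, ⟨S, hS, hx⟩, y, ⟨T, hT, hy⟩, h3⟩)
    · subst h1
      refine ⟨(↑(fun _ : I => (∅ : Set A)) : Star U (Set A)), ?_, ?_⟩
      · intro y
        induction y using Germ.inductionOn with
        | _ y =>
          intro (hy : ∀ᶠ i in (U : Filter I), y i ∈ (∅ : Set A))
          obtain ⟨i, hi⟩ := hy.exists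
          exact hi.elim
      · exact Eventually.of_forall (f := (U : Filter I)) fun i => Or.inl rfl
    · subst h2
      refine ⟨S, hS, ?_⟩
      induction S using Germ.inductionOn with
      | _ S =>
      induction x using Germ.inductionOn with
      | _ x =>
      have hx' : ∀ᶠ i in (U : Filter I), x i ∈ genStage (S i) (n i) := hx
      exact hx'.mono fun i hi => Or.inr (Or.inl ⟨x i, hi, rfl⟩)
    · subst h3
      induction S using Germ.inductionOn with
      | _ S =>
      induction T using Germ.inductionOn with
      | _ T =>
      induction x using Germ.inductionOn with
      | _ x =>
      induction y using Germ.inductionOn with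
      | _ y =>
      have hx' : ∀ᶠ i in (U : Filter I), x i ∈ genStage (S i) (n i) := hx
      have hy' : ∀ᶠ i in (U : Filter I), y i ∈ genStage (T i) (n i) := hy
      refine ⟨(↑(fun i => S i ∪ T i) : Star U (Set A)), ?_, ?_⟩
      · intro w
        induction w using Germ.inductionOn with
        | _ w =>
          intro (hw : ∀ᶠ i in (U : Filter I), w i ∈ S i ∪ T i)
          rcases Ultrafilter.eventually_or.1 hw with h | h
          · exact hS h
          · exact hT h
      · exact (hx'.and hy').mono fun i hi => Or.inr (Or.inr
          ⟨x i, genStage_mono Set.subset_union_left _ hi.1,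
            y i, genStage_mono Set.subset_union_right _ hi.2, rfl⟩)

end ExtMonad

/-!
The group `ℚˣ` enters only through its countability: exhaust a countable group `G` by an
increasing sequence of subgroups `initialSubgroup G n`, each generated by a finite set.

Let `u = [u_i]` lie in the extension monad. If, for every standard `n`, almost no `u_i` belonged to
`initialSubgroup G n`, then some `f : I → ℕ`, infinite in `*ℕ`, would satisfy
`u_i ∉ initialSubgroup G (f i)` for almost all `i`, and `[initialSubgroup G (f i)]` would be an
internal subgroup containing `G` but not `u`. Hence for some standard `n` almost all `u_i` are
generated by one fixed finite set of standard elements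
(`exists_eventually_mem_of_mem_extensionMonad`). A finite set of standard elements is internal, so
`u` arises from it in hyperfinitely many steps, their number being the class of the stages at which
the `u_i` appear.

Conversely, if `[B_i]` is an internal subgroup, then almost every `B_i` is closed under the group
operations, hence under any number of iterations of them (`eventually_opImage_subset`,
`genStage_subset`); so an internal subgroup containing `G` contains everything generated
hyperfinitely from `G`.
Neither direction distinguishes whether `U` is countably complete.
-/

namespace ExtMonad

open Filter

/-! ### The generation process in a group -/

theorem one_mem_genStage_succ {A : Type*} [One A] [Inv A] [Mul A] (X : Set A) (n : ℕ) :
    (1 : A) ∈ genStage X (n + 1) :=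
  Or.inl rfl

theorem genStage_subset {A : Type*} [One A] [Inv A] [Mul A] {X Y : Set A} (hXY : X ⊆ Y)
    (hY : opImage Y ⊆ Y) (n : ℕ) : genStage X n ⊆ Y := by
  induction n with
  | zero => exact hXY
  | succ n ih => exact (opImage_mono ih).trans hY

/-- The stages increase from the first one on; the initial set need not be contained in the first
stage, which is where `1` enters. -/
theorem genStage_succ_mono {G : Type*} [Group G] (X : Set G) {m n : ℕ} (h : m ≤ n) :
    genStage X (m + 1) ⊆ genStage X (n + 1) := by
  induction n, h using Nat.le_induction with
  | base => exact subset_rfl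
  | succ n _ ih =>
    exact ih.trans fun x hx =>
      Or.inr (Or.inr ⟨x, hx, 1, one_mem_genStage_succ X n, (mul_one x).symm⟩)

theorem exists_mem_genStage_of_mem_closure {G : Type*} [Group G] {X : Set G} {x : G}
    (hx : x ∈ Subgroup.closure X) : ∃ n : ℕ, x ∈ genStage X n := by
  suffices h : ∃ n : ℕ, x ∈ genStage X (n + 1) from h.imp' (· + 1) fun _ h => h
  induction hx using Subgroup.closure_induction with
  | mem x hx => exact ⟨1, Or.inr (Or.inl ⟨x⁻¹, Or.inr (Or.inl ⟨x, hx, rfl⟩), (inv_inv x).symm⟩)⟩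
  | one => exact ⟨0, one_mem_genStage_succ X 0⟩
  | mul x y _ _ ihx ihy =>
    obtain ⟨m, hm⟩ := ihx
    obtain ⟨n, hn⟩ := ihy
    exact ⟨max m n + 1, Or.inr (Or.inr ⟨x, genStage_succ_mono X (le_max_left m n) hm,
      y, genStage_succ_mono X (le_max_right m n) hn, rfl⟩)⟩
  | inv x _ ih =>
    obtain ⟨n, hn⟩ := ih
    exact ⟨n + 1, Or.inr (Or.inl ⟨x, hn, rfl⟩)⟩

theorem val_mem_genStage_image {K : Type*} [DivisionRing K] {X : Set Kˣ} {n : ℕ} {x : Kˣ}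
    (hx : x ∈ genStage X n) : (x : K) ∈ genStage (Units.val '' X) n := by
  induction n generalizing x with
  | zero => exact ⟨x, hx, rfl⟩
  | succ n ih =>
    rcases hx with rfl | ⟨y, hy, rfl⟩ | ⟨y, hy, z, hz, rfl⟩
    · exact Or.inl Units.val_one
    · exact Or.inr (Or.inl ⟨y, ih hy, Units.val_inv_eq_inv_val y⟩)
    · exact Or.inr (Or.inr ⟨y, ih hy, z, ih hz, Units.val_mul y z⟩)

theorem opImage_val_image_subset {K : Type*} [DivisionRing K] {X : Set Kˣ} (hX : opImage X ⊆ X) :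
    opImage (Units.val '' X : Set K) ⊆ Units.val '' X := by
  rintro z (rfl | ⟨_, ⟨x, hx, rfl⟩, rfl⟩ | ⟨_, ⟨x, hx, rfl⟩, _, ⟨y, hy, rfl⟩, rfl⟩)
  · exact ⟨1, hX (Or.inl rfl), Units.val_one⟩
  · exact ⟨x⁻¹, hX (Or.inr (Or.inl ⟨x, hx, rfl⟩)), Units.val_inv_eq_inv_val x⟩
  · exact ⟨x * y, hX (Or.inr (Or.inr ⟨x, hx, y, hy, rfl⟩)), Units.val_mul x y⟩

/-! ### Internal sets and internal subgroups -/

theorem internalSet_const_of_finite {I : Type*} {U : Ultrafilter I} {A : Type*} {T : Set A}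
    (hT : T.Finite) : internalSet (std U T) = std U '' T := by
  ext x
  constructor
  · induction x using Germ.inductionOn with
    | _ x =>
      intro (hx : ∀ᶠ i in (U : Filter I), x i ∈ T)
      have h : ∀ᶠ i in (U : Filter I), ∃ a ∈ T, x i = a := hx.mono fun i hi => ⟨x i, hi, rfl⟩
      obtain ⟨a, ha, hxa⟩ := (Ultrafilter.eventually_exists_mem_iff hT).1 h
      exact ⟨a, ha, (Germ.coe_eq.2 hxa).symm⟩
  · rintro ⟨a, ha, rfl⟩
    exact Eventually.of_forall (f := (U : Filter I)) fun _ => ha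

/-- The internal subgroup `[H_i]` of `*G` given by a family of subgroups of `G`. -/
def starSubgroup {I : Type*} (U : Ultrafilter I) {G : Type*} [Group G] (H : I → Subgroup G) :
    Subgroup (Star U G) where
  carrier := internalSet (↑(fun i => (H i : Set G)) : Star U (Set G))
  one_mem' := Eventually.of_forall (f := (U : Filter I)) fun i => (H i).one_mem
  mul_mem' {x y} := by
    induction x using Germ.inductionOn with
    | _ x =>
    induction y using Germ.inductionOn with
    | _ y =>
      intro (hx : ∀ᶠ i in (U : Filter I), x i ∈ H i) (hy : ∀ᶠ i in (U : Filter I), y i ∈ H i)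
      exact (hx.and hy).mono fun i hi => (H i).mul_mem hi.1 hi.2
  inv_mem' {x} := by
    induction x using Germ.inductionOn with
    | _ x =>
      intro (hx : ∀ᶠ i in (U : Filter I), x i ∈ H i)
      exact hx.mono fun i hi => (H i).inv_mem hi

/-- If `[B_i]` is a subgroup of `*G`, then almost every `B_i` is closed under the group
operations: the first stage generated from `[B_i]` is `[opImage B_i]`. -/
theorem eventually_opImage_subset {I : Type*} {U : Ultrafilter I} {G : Type*} [Group G]
    (H : Subgroup (Star U G)) (B : I → Set G)
    (hB : (H : Set (Star U G)) = internalSet (↑B : Star U (Set G))) :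
    ∀ᶠ i in (U : Filter I), opImage (B i) ⊆ B i := by
  have h₁ : starStage (internalSet (↑B : Star U (Set G))) (0 + 1) =
      internalSet (↑(fun i => opImage (B i)) : Star U (Set G)) :=
    starStage_internalSet _ _
  rw [starStage_succ, starStage_zero, ← hB] at h₁
  rw [← internalSet_subset_iff (U := U) (fun i => opImage (B i)) B, ← h₁, ← hB]
  rintro z (rfl | ⟨x, hx, rfl⟩ | ⟨x, hx, y, hy, rfl⟩)
  · exact H.one_mem
  · exact H.inv_mem hx
  · exact H.mul_mem hx hy

theorem germ_map_injective {I : Type*} (U : Ultrafilter I) {A B : Type*} {f : A → B}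
    (hf : Function.Injective f) :
    Function.Injective (Germ.map f : Star U A → Star U B) := by
  intro x y
  induction x using Germ.inductionOn with
  | _ x =>
  induction y using Germ.inductionOn with
  | _ y =>
    intro h
    exact Germ.coe_eq.2 ((Germ.coe_eq.1 h).mono fun _ hi => hf hi)

/-! ### The extension monad of a countable group -/

/-- The subgroup generated by the elements with code less than `n` in an encoding of `G` by
natural numbers. -/
def initialSubgroup (G : Type*) [Group G] [Encodable G] (n : ℕ) : Subgroup G :=
  Subgroup.closure {g | Encodable.encode g < n}

theorem finite_setOf_encode_lt (G : Type*) [Encodable G] (n : ℕ) :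
    {g : G | Encodable.encode g < n}.Finite :=
  (Set.finite_Iio n).preimage Encodable.encode_injective.injOn

theorem initialSubgroup_mono (G : Type*) [Group G] [Encodable G] :
    Monotone (initialSubgroup G) :=
  fun _ _ h => Subgroup.closure_mono fun _ hg => lt_of_lt_of_le hg h

theorem mem_initialSubgroup {G : Type*} [Group G] [Encodable G] (g : G) {n : ℕ}
    (h : Encodable.encode g < n) : g ∈ initialSubgroup G n :=
  Subgroup.subset_closure h

/-- An element `[u_i]` of the extension monad of a countable group has almost all `u_i` in one
subgroup generated by finitely many standard elements. -/
theorem exists_eventually_mem_of_mem_extensionMonad {I : Type*} {U : Ultrafilter I} {G : Type*}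
    [Group G] [Encodable G] {u : I → G} (hu : (↑u : Star U G) ∈ extensionMonad U G) :
    ∃ n : ℕ, ∀ᶠ i in (U : Filter I), u i ∈ initialSubgroup G n := by
  classical
  by_contra! hnot
  have hex (i : I) : ∃ m, u i ∈ initialSubgroup G (m + 1) :=
    ⟨_, mem_initialSubgroup (u i) (Nat.lt_succ_self _)⟩
  -- `f i` is the largest index with `u i ∉ initialSubgroup G (f i)` as soon as it is positive.
  let f (i : I) : ℕ := Nat.find (hex i)
  have hf (n : ℕ) : ∀ᶠ i in (U : Filter I), n ≤ f i := by
    filter_upwards [hnot n] with i hi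
    by_contra! hlt
    exact hi (initialSubgroup_mono G hlt (Nat.find_spec (hex i)))
  have hmem : (↑u : Star U G) ∈ starSubgroup U fun i => initialSubgroup G (f i) := by
    refine Subgroup.mem_sInf.1 hu _ ⟨⟨_, rfl⟩, fun g => ?_⟩
    exact (hf (Encodable.encode g + 1)).mono fun i hi => mem_initialSubgroup g hi
  have hmem' : ∀ᶠ i in (U : Filter I), u i ∈ initialSubgroup G (f i) := hmem
  obtain ⟨i, hi, hpos⟩ := (hmem'.and (hf 1)).exists
  obtain ⟨k, hk⟩ := Nat.exists_eq_add_of_le' hpos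
  rw [hk] at hi
  exact Nat.find_min (hex i) (show k < f i by omega) hi

/-! ### The multiplicative group of a countable division ring -/

/-- The copy in `*K` of the set of nonzero elements of `K`. -/
def stdNonzero {I : Type*} (U : Ultrafilter I) (K : Type*) [Zero K] : Set (Star U K) :=
  {x | ∃ q : K, q ≠ 0 ∧ x = std U q}

theorem map_val_mem_intGen {I : Type*} {U : Ultrafilter I} {K : Type*} [DivisionRing K]
    [Countable K] {u : Star U Kˣ} (hu : u ∈ extensionMonad U Kˣ) :
    Germ.map Units.val u ∈ intGen (stdNonzero U K) := by
  have : Countable Kˣ := Units.val_injective.countable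
  let _ : Encodable Kˣ := Encodable.ofCountable Kˣ
  induction u using Germ.inductionOn with
  | _ u =>
    obtain ⟨n, hn⟩ := exists_eventually_mem_of_mem_extensionMonad hu
    obtain ⟨ν, hν⟩ := (hn.mono fun i hi => exists_mem_genStage_of_mem_closure hi).choice
    refine Set.mem_iUnion.2 ⟨(↑ν : Star U ℕ),
      std U (Units.val '' {g : Kˣ | Encodable.encode g < n}), ?_,
      hν.mono fun i hi => val_mem_genStage_image hi⟩
    rw [internalSet_const_of_finite ((finite_setOf_encode_lt Kˣ n).image _)]
    rintro _ ⟨_, ⟨g, -, rfl⟩, rfl⟩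
    exact ⟨g, g.ne_zero, rfl⟩

theorem exists_mem_map_val_eq_of_mem_intGen {I : Type*} {U : Ultrafilter I} {K : Type*}
    [DivisionRing K] {x : Star U K} (hx : x ∈ intGen (stdNonzero U K)) {H : Subgroup (Star U Kˣ)}
    (hH : IsInternal (H : Set (Star U Kˣ))) (hstd : ∀ g : Kˣ, std U g ∈ H) :
    ∃ u ∈ H, Germ.map Units.val u = x := by
  obtain ⟨B, hB⟩ := hH
  obtain ⟨ν, S, hS, hx⟩ := Set.mem_iUnion.1 hx
  induction x using Germ.inductionOn with
  | _ x =>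
  induction S using Germ.inductionOn with
  | _ S =>
  induction B using Germ.inductionOn with
  | _ B =>
  induction ν using Germ.inductionOn with
  | _ ν =>
    have hSB : internalSet (↑S : Star U (Set K)) ⊆
        internalSet (↑(fun i => Units.val '' B i) : Star U (Set K)) := by
      intro y hy
      obtain ⟨q, hq, rfl⟩ := hS hy
      have hg : std U (Units.mk0 q hq) ∈ (H : Set (Star U Kˣ)) := hstd _
      rw [hB] at hg
      have hg' : ∀ᶠ i in (U : Filter I), Units.mk0 q hq ∈ B i := hg
      exact hg'.mono fun i hi => ⟨_, hi, rfl⟩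
    rw [internalSet_subset_iff] at hSB
    have hx' : ∀ᶠ i in (U : Filter I), x i ∈ genStage (S i) (ν i) := hx
    have hxB : ∀ᶠ i in (U : Filter I), ∃ u : Kˣ, u ∈ B i ∧ (u : K) = x i := by
      filter_upwards [hx', hSB, eventually_opImage_subset H B hB] with i hxi hSi hBi
      exact genStage_subset hSi (opImage_val_image_subset hBi) _ hxi
    obtain ⟨u, hu⟩ := hxB.choice
    refine ⟨(↑u : Star U Kˣ), ?_, Germ.coe_eq.2 (hu.mono fun i hi => hi.2)⟩
    rw [← SetLike.mem_coe, hB]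
    exact hu.mono fun i hi => hi.1

/-- For a countable division ring, the extension monad of the multiplicative group consists of the
elements generated hyperfinitely from the standard ones. -/
theorem map_val_image_extensionMonad {I : Type*} (U : Ultrafilter I) (K : Type*) [DivisionRing K]
    [Countable K] :
    Germ.map Units.val '' (extensionMonad U Kˣ : Set (Star U Kˣ)) = intGen (stdNonzero U K) := by
  apply Set.Subset.antisymm
  · rintro _ ⟨u, hu, rfl⟩
    exact map_val_mem_intGen hu
  · intro x hx
    -- The whole of `*Kˣ` is internal, which yields one preimage of `x`, the only one.
    obtain ⟨u, -, rfl⟩ := exists_mem_map_val_eq_of_mem_intGen hx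
      (H := starSubgroup U fun _ => ⊤) ⟨_, rfl⟩
      fun g => Eventually.of_forall (f := (U : Filter I)) fun _ => Subgroup.mem_top g
    refine ⟨u, Subgroup.mem_sInf.2 fun H hH => ?_, rfl⟩
    obtain ⟨v, hv, hvu⟩ := exists_mem_map_val_eq_of_mem_intGen hx hH.1 hH.2
    exact germ_map_injective U Units.val_injective hvu ▸ hv

end ExtMonad

theorem mainTheorem8 {I : Type*} (U : Ultrafilter I) (hU : ∀ i : I, U ≠ pure i) :
    Filter.Germ.map (fun q : ℚˣ => (q : ℚ)) ''
        (ExtMonad.extensionMonad U ℚˣ : Set (ExtMonad.Star U ℚˣ)) =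
      ExtMonad.intGen {x : ExtMonad.Star U ℚ | ∃ q : ℚ, q ≠ 0 ∧ x = ExtMonad.std U q} :=
  ExtMonad.map_val_image_extensionMonad U ℚ
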